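/- For positive integers $n,q$ let $f=f_{n,q}:[q]^n\to\{0,1\}$ be the element distinctness function: $f(x)=0$ if $x_1,\dots,x_n$ are pairwise distinct and $f(x)=1$ otherwise. An adversary matrix for $f$ is a non-zero real matrix $\Gamma$ with rows indexed by $f^{-1}(1)$ and columns indexed by $f^{-1}(0)$. For $i\in[n]$ let $\Delta_i$ be the matrix of the same shape with $(\Delta_i)_{x,y}=1$ if $x_i\ne y_i$ and $0$ otherwise; let $\|\cdot\|$ be the spectral norm and $\circ$ the entrywise product. The negative-weight adversary bound is $$\mathrm{Adv}(f)=\sup_{\Gamma}\frac{\|\Gamma\|}{\max_{i\in[n]}\|\Gamma\circ\Delta_i\|},$$ the supremum being over all adversary matrices for $f$. Let $E_0$ be the $q\times q$ matrix with all entries $1/q$, and $E_1=I-E_0$. For a finite index set $S$ let $E_k^{S}=\sum_{v\in\{0,1\}^S,\,|v|=k}\bigotimes_{i\in S}E_{v_i}$, the projector onto the weight-$k$ eigenspace of the Hamming association scheme on $[q]^S$; write $E_k^{(m)}$ when $S=[m]$. For $\ell\in\{0,1\}$ let $F_\ell$ be the $q\times q^2$ matrix consisting of the rows $(s,s)$,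 $s\in[q]$, of $\sqrt q\,E^{(2)}_\ell$. Given reals $\alpha_0,\alpha_1,\dots\ge 0$ and $1\le a<b\le n$, let $G_{a,b}$ be the matrix with rows indexed by the $x\in[q]^n$ with $x_a=x_b$, columns indexed by $y\in[q]^n$, and $$G_{a,b}=\sum_{k=0}^{n-2}\alpha_k\,(F_0+F_1)\otimes E_k^{[n]\setminus\{a,b\}},$$ where $F_0+F_1$ acts on positions $a,b$. Let $\Gamma'_\alpha$ be the matrix obtained by stacking all blocks $G_{a,b}$, and let $\Gamma_\alpha$ be obtained from it by striking out every column $y$ with two equal symbols and every row $x$ of a block $G_{a,b}$ with $x_i=x_j$ for some $i\neq j$, $\{i,j\}\ne\{a,b\}$; adding zero rows for inputs with more than one colliding pair, regard $\Gamma_\alpha$ as a matrix with rows indexed by $f^{-1}(1)$ and columns indexed by $f^{-1}(0)$. Theorem. For every $c>0$ there is a constant $C>0$, depending only on $c$, such that for all $n\ge 2$ and all $q\ge n$ with $q\ge c\,n^2$ there exists an adversary matrix $\Gamma$ for $f_{n,q}$, of the form $\Gamma=\Gamma_\alpha$ for some non-negative reals $\alpha_k$, such that $\max_{i}\|\Gamma\circ\Delta_i\|>0$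 and $$\frac{\|\Gamma\|}{\max_{i\in[n]}\|\Gamma\circ\Delta_i\|}\ \ge\ C\,n^{2/3}.$$ In particular, $\mathrm{Adv}(f_{n,q})\ge C\,n^{2/3}$. -/

import Mathlib

open scoped Matrix ENNReal

noncomputable section

namespace AdvED

/-! ### The negative-weight adversary bound

Inputs are strings in `[q]^n`, modelled as `Fin n → Fin q`; the values `0`, `1` of a Boolean
function are `false`, `true`. -/

/-- `f⁻¹(1)`: the row labels of adversary matrices for `f`. -/
abbrev Pos {n q : ℕ} (f : (Fin n → Fin q) → Bool) : Type := {x : Fin n → Fin q // f x = true}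

/-- `f⁻¹(0)`: the column labels of adversary matrices for `f`. -/
abbrev Neg {n q : ℕ} (f : (Fin n → Fin q) → Bool) : Type := {y : Fin n → Fin q // f y = false}

/-- Real matrices with rows indexed by `f⁻¹(1)` and columns indexed by `f⁻¹(0)`.
The set of adversary matrices consists of the nonzero ones. -/
abbrev AdvMatrix {n q : ℕ} (f : (Fin n → Fin q) → Bool) : Type := Matrix (Pos f) (Neg f) ℝ

/-- The 0/1 matrix `Δ_i`, with entry `(x, y)` equal to `1` iff `x_i ≠ y_i`. -/
def Delta {n q : ℕ} (f : (Fin n → Fin q) → Bool) (i : Fin n) : AdvMatrix f :=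
  Matrix.of fun x y => if x.1 i ≠ y.1 i then 1 else 0

section

open scoped Matrix.Norms.L2Operator

/-- The spectral norm (largest singular value) of a real matrix: its operator norm with respect to
the Euclidean norms. -/
def specNorm {m k : Type*} [Fintype m] [Fintype k] [DecidableEq k] (A : Matrix m k ℝ) : ℝ := ‖A‖

end

/-- `max_i ‖Γ ∘ Δ_i‖`, with `∘` the entrywise product. -/
def maxDeltaNorm {n q : ℕ} (f : (Fin n → Fin q) → Bool) (Γ : AdvMatrix f) : ℝ :=
  ⨆ i : Fin n, specNorm (Γ ⊙ Delta f i)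

/-- The adversary quotient `‖Γ‖ / max_i ‖Γ ∘ Δ_i‖`. The denominator is positive for every
nonzero `Γ`, since a row label and a column label always differ in some position. -/
def advRatio {n q : ℕ} (f : (Fin n → Fin q) → Bool) (Γ : AdvMatrix f) : ℝ :=
  specNorm Γ / maxDeltaNorm f Γ

/-- The negative-weight adversary bound of `f`: the supremum of the adversary quotient over all
nonzero adversary matrices (taken in `[0, ∞]`, so that no boundedness has to be known). -/
def adv {n q : ℕ} (f : (Fin n → Fin q) → Bool) : ℝ≥0∞ :=
  ⨆ (Γ : AdvMatrix f) (_ : Γ ≠ 0), ENNReal.ofReal (advRatio f Γ)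

/-- Element distinctness on `[q]^n`: `0` if all symbols are pairwise distinct, `1` otherwise. -/
def elementDistinctness (n q : ℕ) (x : Fin n → Fin q) : Bool :=
  decide (∃ i j : Fin n, i ≠ j ∧ x i = x j)

/-! ### The explicit matrices built from the Hamming association scheme -/

/-- `E₀`: the projector onto the constant vectors of `ℝ^q`; all entries are `1/q`. -/
def E0 (q : ℕ) : Matrix (Fin q) (Fin q) ℝ := Matrix.of fun _ _ => 1 / (q : ℝ)

/-- `E₁ = I - E₀`: the projector onto the orthogonal complement of the constant vectors. -/
def E1 (q : ℕ) : Matrix (Fin q) (Fin q) ℝ := 1 - E0 q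

/-- The projector `E_k` onto the weight-`k` eigenspace of the Hamming association scheme on
`[q]^ι`: the sum, over all `v ∈ {0,1}^ι` of weight `k` (given by their supports), of the tensor
products `⊗_i E_{v_i}`. -/
def hammingProj (q : ℕ) (ι : Type) [Fintype ι] [DecidableEq ι] (k : ℕ) :
    Matrix (ι → Fin q) (ι → Fin q) ℝ :=
  Matrix.of fun x y => ∑ v ∈ (Finset.univ : Finset ι).powersetCard k,
    ∏ i, if i ∈ v then E1 q (x i) (y i) else E0 q (x i) (y i)

/-- The `q × q²` matrix `F_ℓ`: the multiple `√q · E_ℓ^{(2)}`, of which only the rows `(s, s)` with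
two equal symbols are kept. -/
def F (q l : ℕ) : Matrix (Fin q) (Fin q × Fin q) ℝ :=
  Matrix.of fun s t => √(q : ℝ) * hammingProj q (Fin 2) l ![s, s] ![t.1, t.2]

/-- The block `G_{a,b} = ∑_k α_k (F₀ + F₁) ⊗ E_k^{(n-2)}`, where `F₀ + F₁` acts on the positions
`a, b` and `E_k^{(n-2)}` on the other positions. It is used for rows `x` with `x_a = x_b`. -/
def G (n q : ℕ) (α : ℕ → ℝ) (a b : Fin n) (x y : Fin n → Fin q) : ℝ :=
  ∑ k ∈ Finset.range (n - 1),
    α k * ((F q 0 + F q 1) (x a) (y a, y b) *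
      hammingProj q {i : Fin n // i ≠ a ∧ i ≠ b} k (fun i => x i) (fun i => y i))

/-- Row labels of the enlarged matrix: a pair `a < b` of positions together with a string `x`
such that `x_a = x_b`. -/
abbrev ExtRow (n q : ℕ) : Type :=
  {r : (Fin n × Fin n) × (Fin n → Fin q) // r.1.1 < r.1.2 ∧ r.2 r.1.1 = r.2 r.1.2}

/-- The enlarged matrix `Γ'`: the blocks `G_{a,b}`, `a < b`, stacked on one another. -/
def enlargedMatrix (n q : ℕ) (α : ℕ → ℝ) : Matrix (ExtRow n q) (Fin n → Fin q) ℝ :=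
  Matrix.of fun r y => G n q α r.1.1.1 r.1.1.2 r.1.2 y

/-- A row `x` of the block `G_{a,b}` is legal if `x_i = x_j` for no pair `i < j` other than
`a < b`. -/
def ExtRow.Legal {n q : ℕ} (r : ExtRow n q) : Prop :=
  ∀ i j : Fin n, i < j → r.1.2 i = r.1.2 j → (i, j) = r.1.1

open Classical in
/-- The matrix `Γ` obtained from `Γ'` by striking out all illegal rows and columns. A positive
input labels at most one legal row; positive inputs labelling none (those with more than one
colliding pair) receive a zero row. The legal columns are exactly the negative inputs. -/
def struckMatrix (n q : ℕ) (α : ℕ → ℝ) : AdvMatrix (elementDistinctness n q) :=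
  Matrix.of fun x y => ∑ r : ExtRow n q,
    if r.Legal ∧ r.1.2 = x.1 then enlargedMatrix n q α r y.1 else 0

end AdvED

end

/-!
The matrices `E_S = ⨂_j E_{[j ∈ S]}` are the orthogonal eigenprojectors of the Hamming scheme. A
block `G_{a,b}` is `√q ∑_S t_S E_S` restricted to the rows with `x_a = x_b`, where `t_S` is the
weight `α_k`, `k = |S \ {a, b}|`, unless `S` contains both `a` and `b`, when it is `0`. A function
independent of `x_a` has `1/q` of its sum on this diagonal, which cancels the factor `√q`, so
squared norms of blocks become sums over `S` of `t_S²` times the squared length of `E_S v`.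

*Denominator.* Where `x_i ≠ y_i`, the entries of `E₁` and `-E₀` agree, so in `Γ' ∘ Δ_i` the
projector `E_{S ∪ {i}}` can be replaced by `-E_S`. For `i ∉ {a, b}` this leaves the differences
`α_k - α_{k+1}`, which are at most `1/n` and are summed over fewer than `n²` blocks. In the blocks
`G_{i,b}` only the supports `S ∋ b` survive; each `S` occurs in `|S|` of them, which costs
`|S| α_{|S|-1}²`. Removing the entries with `x_i = y_i` again at most doubles the norm.

*Numerator.* Apply the matrix to the indicator `w` of the legal columns. In the row `x` of the
block `G_{a,b}`, the average of `w` over the coordinate `a` vanishes unless the row is legal.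
Pairing the image of `w` with these averages therefore sees the legal rows only, while it can be
computed in the unrestricted scheme, where all terms are nonnegative and `S = ∅` alone suffices.

The choice `α_k = max(n^{-1/3} - k/n, 0)` keeps the denominator bounded, and the numerator is of
order `n α_0 = n^{2/3}` because for `q ≥ c n²` a constant fraction of all strings has pairwise
distinct symbols.
-/

noncomputable section

namespace AdvED

open Finset

section PiKronecker

variable {ι m R : Type*} [Fintype ι] [CommSemiring R]

/-- The tensor product `⨂_j A_j` of square matrices, acting on functions of the strings `ι → m`. -/
def piKronecker (A : ι → Matrix m m R) : Matrix (ι → m) (ι → m) R :=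
  Matrix.of fun x y => ∏ j, A j (x j) (y j)

lemma piKronecker_apply (A : ι → Matrix m m R) (x y : ι → m) :
    piKronecker A x y = ∏ j, A j (x j) (y j) := rfl

lemma transpose_piKronecker (A : ι → Matrix m m R) :
    (piKronecker A)ᵀ = piKronecker fun j => (A j)ᵀ := rfl

lemma piKronecker_eq_zero {A : ι → Matrix m m R} {j : ι} (hj : A j = 0) : piKronecker A = 0 := by
  ext x y
  exact prod_eq_zero (mem_univ j) (by simp [hj])

lemma piKronecker_one [DecidableEq m] : piKronecker (fun _ : ι => (1 : Matrix m m R)) = 1 := by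
  ext x y
  simp only [piKronecker_apply, Matrix.one_apply, prod_ite_zero, prod_const_one, funext_iff,
    mem_univ, true_imp_iff]

variable [DecidableEq ι]

lemma piKronecker_mul_piKronecker [Fintype m] (A B : ι → Matrix m m R) :
    piKronecker A * piKronecker B = piKronecker fun j => A j * B j := by
  ext x z
  simp only [Matrix.mul_apply, piKronecker_apply, ← prod_mul_distrib]
  exact (Fintype.prod_sum fun j t => A j (x j) t * B j t (z j)).symm

lemma piKronecker_add (A B : ι → Matrix m m R) :
    piKronecker (fun j => A j + B j)
      = ∑ S : Finset ι, piKronecker fun j => if j ∈ S then A j else B j := by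
  ext x y
  simp only [Matrix.sum_apply, piKronecker_apply, Matrix.add_apply, Fintype.prod_add]
  refine sum_congr rfl fun S _ => ?_
  rw [← prod_mul_prod_compl S]
  congr 1
  · exact prod_congr rfl fun j hj => by rw [if_pos hj]
  · exact prod_congr rfl fun j hj => by rw [if_neg (mem_compl.1 hj)]

end PiKronecker

section HammingScheme

variable {ι : Type*} [Fintype ι] [DecidableEq ι] {q : ℕ}

lemma E1_apply (s t : Fin q) : E1 q s t = (if s = t then 1 else 0) - 1 / (q : ℝ) := by
  simp [E1, E0, Matrix.one_apply]

lemma E0_transpose : (E0 q)ᵀ = E0 q := rfl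

lemma E1_transpose : (E1 q)ᵀ = E1 q := by
  rw [E1, Matrix.transpose_sub, Matrix.transpose_one, E0_transpose]

lemma isIdempotentElem_E0 : IsIdempotentElem (E0 q) := by
  ext s t
  have hq : (q : ℝ) ≠ 0 := mod_cast s.pos.ne'
  simp [E0, Matrix.mul_apply, hq]

lemma isIdempotentElem_E1 : IsIdempotentElem (E1 q) := isIdempotentElem_E0.one_sub

lemma E0_mul_E1 : E0 q * E1 q = 0 := isIdempotentElem_E0.mul_one_sub_self

lemma E1_mul_E0 : E1 q * E0 q = 0 := isIdempotentElem_E0.one_sub_mul_self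

/-- The tensor product `E_S = ⨂_j E_{[j ∈ S]}`. These are the joint eigenprojectors of the Hamming
scheme, refining `hammingProj` from weights to supports. -/
def tensorProj (q : ℕ) (S : Finset ι) : Matrix (ι → Fin q) (ι → Fin q) ℝ :=
  piKronecker fun j => if j ∈ S then E1 q else E0 q

lemma tensorProj_apply (S : Finset ι) (x y : ι → Fin q) :
    tensorProj q S x y = ∏ j, if j ∈ S then E1 q (x j) (y j) else E0 q (x j) (y j) :=
  prod_congr rfl fun j _ => by dsimp only; split_ifs <;> rfl

lemma transpose_tensorProj (S : Finset ι) : (tensorProj q S)ᵀ = tensorProj q S := by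
  simp only [tensorProj, transpose_piKronecker, apply_ite Matrix.transpose, E0_transpose,
    E1_transpose]

lemma isIdempotentElem_tensorProj (S : Finset ι) : IsIdempotentElem (tensorProj q S) := by
  rw [IsIdempotentElem, tensorProj, piKronecker_mul_piKronecker]
  congr 1
  funext j
  split_ifs
  exacts [isIdempotentElem_E1, isIdempotentElem_E0]

lemma tensorProj_mul_tensorProj_of_ne {S T : Finset ι} (h : S ≠ T) :
    tensorProj q S * tensorProj q T = 0 := by
  obtain ⟨j, hj⟩ : ∃ j, ¬ (j ∈ S ↔ j ∈ T) := by
    by_contra! h'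
    exact h (Finset.ext h')
  rw [tensorProj, tensorProj, piKronecker_mul_piKronecker]
  refine piKronecker_eq_zero (j := j) ?_
  by_cases hS : j ∈ S <;> simp_all [E0_mul_E1, E1_mul_E0]

lemma sum_tensorProj : ∑ S : Finset ι, tensorProj q S = 1 := by
  simp only [tensorProj, ← piKronecker_add, E1, sub_add_cancel, piKronecker_one]

lemma dependsOn_tensorProj_apply (S : Finset ι) (y : ι → Fin q) :
    DependsOn (fun x => tensorProj q S x y) S := by
  intro x x' h
  simp only [tensorProj_apply]
  refine prod_congr rfl fun j _ => ?_
  by_cases hj : j ∈ S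
  · rw [h j hj]
  · simp [hj, E0]

lemma dependsOn_tensorProj_mulVec (S : Finset ι) (v : (ι → Fin q) → ℝ) :
    DependsOn (tensorProj q S *ᵥ v) S := by
  intro x x' h
  exact sum_congr rfl fun y _ => by rw [dependsOn_tensorProj_apply S y h]

/-- The squared length of the component of `v` in the eigenspace with support `S`. -/
def energy (S : Finset ι) (v : (ι → Fin q) → ℝ) : ℝ := v ⬝ᵥ tensorProj q S *ᵥ v

lemma tensorProj_mulVec_dotProduct (S : Finset ι) (v w : (ι → Fin q) → ℝ) :
    (tensorProj q S *ᵥ v) ⬝ᵥ w = v ⬝ᵥ tensorProj q S *ᵥ w := by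
  rw [Matrix.dotProduct_mulVec, ← Matrix.mulVec_transpose, transpose_tensorProj]

lemma tensorProj_mulVec_dotProduct_self (S : Finset ι) (v : (ι → Fin q) → ℝ) :
    (tensorProj q S *ᵥ v) ⬝ᵥ (tensorProj q S *ᵥ v) = energy S v := by
  rw [tensorProj_mulVec_dotProduct, Matrix.mulVec_mulVec, isIdempotentElem_tensorProj, energy]

lemma tensorProj_mulVec_dotProduct_of_ne {S T : Finset ι} (h : S ≠ T) (v : (ι → Fin q) → ℝ) :
    (tensorProj q S *ᵥ v) ⬝ᵥ (tensorProj q T *ᵥ v) = 0 := by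
  rw [tensorProj_mulVec_dotProduct, Matrix.mulVec_mulVec, tensorProj_mul_tensorProj_of_ne h,
    Matrix.zero_mulVec, dotProduct_zero]

lemma energy_nonneg (S : Finset ι) (v : (ι → Fin q) → ℝ) : 0 ≤ energy S v := by
  rw [← tensorProj_mulVec_dotProduct_self]
  exact sum_nonneg fun x _ => mul_self_nonneg _

lemma sum_energy (v : (ι → Fin q) → ℝ) : ∑ S, energy S v = ∑ x, v x ^ 2 := by
  simp only [energy, ← dotProduct_sum, ← Matrix.sum_mulVec, sum_tensorProj, Matrix.one_mulVec]
  simp only [dotProduct, sq]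

lemma energy_empty (v : (ι → Fin q) → ℝ) :
    energy ∅ v = (∑ x, v x) ^ 2 / (q : ℝ) ^ Fintype.card ι := by
  simp only [energy, dotProduct, Matrix.mulVec, tensorProj_apply, notMem_empty, if_false, E0,
    Matrix.of_apply, prod_const, card_univ, ← mul_sum, ← sum_mul]
  rw [one_div, inv_pow]
  ring

/-- The operator `∑_S t_S E_S` with eigenvalue `t_S` on the eigenspace with support `S`. -/
def schemeMatrix (q : ℕ) (t : Finset ι → ℝ) : Matrix (ι → Fin q) (ι → Fin q) ℝ :=
  ∑ S, t S • tensorProj q S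

lemma schemeMatrix_apply (t : Finset ι → ℝ) (x y : ι → Fin q) :
    schemeMatrix q t x y = ∑ S, t S * tensorProj q S x y := by
  simp [schemeMatrix, Matrix.sum_apply]

lemma schemeMatrix_add (t u : Finset ι → ℝ) :
    schemeMatrix q (t + u) = schemeMatrix q t + schemeMatrix q u := by
  simp only [schemeMatrix, Pi.add_apply, add_smul, sum_add_distrib]

lemma schemeMatrix_mulVec (t : Finset ι → ℝ) (v : (ι → Fin q) → ℝ) :
    schemeMatrix q t *ᵥ v = ∑ S, t S • tensorProj q S *ᵥ v := by
  simp only [schemeMatrix, Matrix.sum_mulVec, Matrix.smul_mulVec]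

lemma sum_schemeMatrix_mulVec_sq (t : Finset ι → ℝ) (v : (ι → Fin q) → ℝ) :
    ∑ x, (schemeMatrix q t *ᵥ v) x ^ 2 = ∑ S, t S ^ 2 * energy S v := by
  calc ∑ x, (schemeMatrix q t *ᵥ v) x ^ 2
      = (schemeMatrix q t *ᵥ v) ⬝ᵥ (schemeMatrix q t *ᵥ v) := by simp only [sq, dotProduct]
    _ = ∑ S, ∑ T, t S * (t T * (tensorProj q T *ᵥ v) ⬝ᵥ (tensorProj q S *ᵥ v)) := by
        simp only [schemeMatrix_mulVec, sum_dotProduct, dotProduct_sum, smul_dotProduct,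
          dotProduct_smul, smul_eq_mul, mul_sum]
    _ = ∑ S, t S ^ 2 * energy S v := by
        refine sum_congr rfl fun S _ => ?_
        rw [Fintype.sum_eq_single S fun T hT => by
          rw [tensorProj_mulVec_dotProduct_of_ne hT, mul_zero, mul_zero],
          tensorProj_mulVec_dotProduct_self]
        ring

lemma dependsOn_schemeMatrix_mulVec {t : Finset ι → ℝ} {a : ι} (ht : ∀ S, a ∈ S → t S = 0)
    (v : (ι → Fin q) → ℝ) : DependsOn (schemeMatrix q t *ᵥ v) {a}ᶜ := by
  intro x x' h
  simp only [schemeMatrix_mulVec, Finset.sum_apply, Pi.smul_apply]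
  refine sum_congr rfl fun S _ => ?_
  by_cases ha : a ∈ S
  · simp [ht S ha]
  · rw [dependsOn_tensorProj_mulVec S v fun j hj => h j fun hja => ha (hja ▸ hj)]

end HammingScheme

section Coordinates

variable {ι σ : Type*} [DecidableEq ι] [Fintype σ]

/-- The average of `v` over the coordinate `a`. -/
def coordAvg (a : ι) (v : (ι → σ) → ℝ) (x : ι → σ) : ℝ :=
  (∑ s, v (Function.update x a s)) / Fintype.card σ

lemma dependsOn_coordAvg (a : ι) (v : (ι → σ) → ℝ) : DependsOn (coordAvg a v) {a}ᶜ := by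
  intro x y h
  have hxy (s : σ) : Function.update x a s = Function.update y a s := by
    ext j
    rcases eq_or_ne j a with rfl | hj
    · simp
    · simp [hj, h j hj]
  simp only [coordAvg, hxy]

lemma coordAvg_eq_of_comp_swap {v : (ι → σ) → ℝ} {a b : ι}
    (hv : ∀ x, v (x ∘ Equiv.swap a b) = v x) {x : ι → σ} (hx : x a = x b) :
    coordAvg a v x = coordAvg b v x := by
  have hswap (s : σ) : Function.update x a s = Function.update x b s ∘ Equiv.swap a b := by
    ext j
    simp only [Function.comp_apply, Function.update_apply, Equiv.swap_apply_def]
    grind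
  simp only [coordAvg, hswap, hv]

variable [Fintype ι]

lemma sum_sum_update {M : Type*} [AddCommMonoid M] (a : ι) (f : (ι → σ) → M) :
    ∑ x, ∑ s, f (Function.update x a s) = Fintype.card σ • ∑ x, f x := by
  have hinv : Function.Involutive
      fun p : (ι → σ) × σ => (Function.update p.1 a p.2, p.1 a) := by
    rintro ⟨x, s⟩
    simp
  have h := Equiv.sum_comp hinv.toPerm fun p => f p.1
  rw [Fintype.sum_prod_type, Fintype.sum_prod_type] at h
  simpa [sum_nsmul] using h

lemma card_smul_sum_diagonal [DecidableEq σ] {M : Type*} [AddCommMonoid M] {a b : ι} (hab : a ≠ b)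
    {h : (ι → σ) → M} (hh : DependsOn h {a}ᶜ) :
    Fintype.card σ • ∑ x with x a = x b, h x = ∑ x, h x := by
  have hupd (x : ι → σ) (s : σ) : h (Function.update x a s) = h x :=
    hh fun j hj => Function.update_of_ne hj _ _
  rw [sum_filter, ← sum_sum_update a]
  simp [hupd, Function.update_of_ne hab.symm]

lemma sum_coordAvg [Nonempty σ] (a : ι) (v : (ι → σ) → ℝ) : ∑ x, coordAvg a v x = ∑ x, v x := by
  simp only [coordAvg, ← sum_div, sum_sum_update, nsmul_eq_mul]
  field_simp

lemma sum_coordAvg_mul [Nonempty σ] {a : ι} {f : (ι → σ) → ℝ} (hf : DependsOn f {a}ᶜ)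
    (v : (ι → σ) → ℝ) : ∑ x, coordAvg a v x * f x = ∑ x, v x * f x := by
  rw [← sum_coordAvg a fun x => v x * f x]
  refine sum_congr rfl fun x _ => ?_
  have hupd (s : σ) : f (Function.update x a s) = f x :=
    hf fun j hj => Function.update_of_ne hj _ _
  simp only [coordAvg, hupd, ← sum_mul, div_mul_eq_mul_div]

lemma sum_coordAvg_sq_le [Nonempty σ] (a : ι) (v : (ι → σ) → ℝ) :
    ∑ x, coordAvg a v x ^ 2 ≤ ∑ x, v x ^ 2 := by
  rw [← sum_coordAvg a fun x => v x ^ 2]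
  exact sum_le_sum fun x _ => sum_div_card_sq_le_sum_sq_div_card

end Coordinates

section DiagonalSums

variable {ι : Type*} [Fintype ι] [DecidableEq ι] {q : ℕ} {a b : ι}

lemma mul_sum_diagonal_schemeMatrix_mulVec_sq (hab : a ≠ b) {t : Finset ι → ℝ}
    (ht : ∀ S, a ∈ S → t S = 0) (v : (ι → Fin q) → ℝ) :
    q * ∑ x with x a = x b, (schemeMatrix q t *ᵥ v) x ^ 2 = ∑ S, t S ^ 2 * energy S v := by
  have hdep : DependsOn (fun x => (schemeMatrix q t *ᵥ v) x ^ 2) {a}ᶜ := fun x y hxy => by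
    simp only [dependsOn_schemeMatrix_mulVec ht v hxy]
  simpa [sum_schemeMatrix_mulVec_sq] using card_smul_sum_diagonal hab hdep

lemma mul_sum_diagonal_schemeMatrix_mulVec_sq_le (hab : a ≠ b) {t : Finset ι → ℝ}
    (ht : ∀ S, a ∈ S → b ∈ S → t S = 0) (v : (ι → Fin q) → ℝ) :
    q * ∑ x with x a = x b, (schemeMatrix q t *ᵥ v) x ^ 2
      ≤ 2 * ∑ S, t S ^ 2 * energy S v := by
  set t₁ : Finset ι → ℝ := fun S => if a ∈ S then 0 else t S with ht₁
  set t₂ : Finset ι → ℝ := fun S => if a ∈ S then t S else 0 with ht₂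
  have hsplit : t = t₁ + t₂ := by
    ext S
    by_cases ha : a ∈ S <;> simp [ht₁, ht₂, ha]
  have hsq (S : Finset ι) : t S ^ 2 = t₁ S ^ 2 + t₂ S ^ 2 := by
    by_cases ha : a ∈ S <;> simp [ht₁, ht₂, ha]
  have h₁ := mul_sum_diagonal_schemeMatrix_mulVec_sq hab (t := t₁) (by simp +contextual [ht₁]) v
  have h₂ := mul_sum_diagonal_schemeMatrix_mulVec_sq hab.symm (t := t₂)
    (fun S hb => by by_cases ha : a ∈ S <;> simp [ht₂, ha, ht S, hb]) v
  have hcomm (x : ι → Fin q) : x b = x a ↔ x a = x b := eq_comm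
  simp only [hcomm] at h₂
  calc q * ∑ x with x a = x b, (schemeMatrix q t *ᵥ v) x ^ 2
      ≤ q * ∑ x with x a = x b,
          2 * ((schemeMatrix q t₁ *ᵥ v) x ^ 2 + (schemeMatrix q t₂ *ᵥ v) x ^ 2) := by
        gcongr with x
        rw [hsplit, schemeMatrix_add, Matrix.add_mulVec]
        exact add_sq_le
    _ = 2 * (∑ S, t₁ S ^ 2 * energy S v + ∑ S, t₂ S ^ 2 * energy S v) := by
        rw [← h₁, ← h₂, ← mul_sum, sum_add_distrib]
        ring
    _ = 2 * ∑ S, t S ^ 2 * energy S v := by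
        simp only [hsq, add_mul, sum_add_distrib]

lemma mul_sum_diagonal_coordAvg_mul_tensorProj_mulVec [NeZero q] (hab : a ≠ b) {S : Finset ι}
    (ha : a ∉ S) (w : (ι → Fin q) → ℝ) :
    q * ∑ x with x a = x b, coordAvg a w x * (tensorProj q S *ᵥ w) x = energy S w := by
  have hdep : DependsOn (tensorProj q S *ᵥ w) {a}ᶜ :=
    (dependsOn_tensorProj_mulVec S w).mono fun j hj hja => ha (hja ▸ hj)
  have hmul : DependsOn (fun x => coordAvg a w x * (tensorProj q S *ᵥ w) x) {a}ᶜ :=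
    fun x y hxy => by simp only [dependsOn_coordAvg a w hxy, hdep hxy]
  simpa [sum_coordAvg_mul hdep, energy, dotProduct] using card_smul_sum_diagonal hab hmul

lemma mul_sum_diagonal_coordAvg_mul_schemeMatrix_mulVec [NeZero q] (hab : a ≠ b)
    {t : Finset ι → ℝ} (ht : ∀ S, a ∈ S → b ∈ S → t S = 0) {w : (ι → Fin q) → ℝ}
    (hw : ∀ x, w (x ∘ Equiv.swap a b) = w x) :
    q * ∑ x with x a = x b, coordAvg a w x * (schemeMatrix q t *ᵥ w) x
      = ∑ S, t S * energy S w := by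
  have hS (S : Finset ι) :
      t S * (q * ∑ x with x a = x b, coordAvg a w x * (tensorProj q S *ᵥ w) x)
        = t S * energy S w := by
    by_cases ha : a ∈ S
    · by_cases hb : b ∈ S
      · simp [ht S ha hb]
      · rw [← mul_sum_diagonal_coordAvg_mul_tensorProj_mulVec hab.symm hb]
        congr 2
        refine sum_congr (by simp only [eq_comm]) fun x hx => ?_
        rw [coordAvg_eq_of_comp_swap hw (mem_filter.1 hx).2.symm]
    · rw [mul_sum_diagonal_coordAvg_mul_tensorProj_mulVec hab ha]
  simp only [← hS, schemeMatrix_mulVec, Finset.sum_apply, Pi.smul_apply, smul_eq_mul, mul_sum]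
  rw [sum_comm]
  exact sum_congr rfl fun S _ => sum_congr rfl fun x _ => by ring

end DiagonalSums

section Fold

variable {ι : Type*} [Fintype ι] [DecidableEq ι] {q : ℕ} {i : ι}

lemma tensorProj_insert_apply_of_ne {S : Finset ι} (hi : i ∉ S) {x y : ι → Fin q}
    (hxy : x i ≠ y i) : tensorProj q (insert i S) x y = -tensorProj q S x y := by
  rw [tensorProj_apply, tensorProj_apply, ← mul_prod_erase univ _ (mem_univ i),
    ← mul_prod_erase univ _ (mem_univ i), ← neg_mul]
  congr 1
  · simp [hi, E1_apply, hxy, E0]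
  · refine prod_congr rfl fun j hj => ?_
    simp only [mem_insert, ne_of_mem_erase hj, false_or]

/-- The coefficients obtained from `t` by folding the supports containing `i` onto those without
`i`. On the entries with `x i ≠ y i` this does not change the scheme matrix, because there `E₁`
and `-E₀` agree in the coordinate `i`. -/
def foldCoeff (i : ι) (t : Finset ι → ℝ) (S : Finset ι) : ℝ :=
  if i ∈ S then 0 else t S - t (insert i S)

lemma schemeMatrix_foldCoeff_apply (t : Finset ι → ℝ) {x y : ι → Fin q} (hxy : x i ≠ y i) :
    schemeMatrix q (foldCoeff i t) x y = schemeMatrix q t x y := by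
  have huniv : (univ : Finset (Finset ι)) = (insert i (univ.erase i)).powerset := by
    rw [insert_erase (mem_univ i), powerset_univ]
  simp only [schemeMatrix_apply]
  rw [huniv, sum_powerset_insert (notMem_erase i univ), sum_powerset_insert (notMem_erase i univ),
    ← sum_add_distrib, ← sum_add_distrib]
  refine sum_congr rfl fun S hS => ?_
  have hi : i ∉ S := fun h => notMem_erase i univ (mem_powerset.1 hS h)
  simp only [foldCoeff, hi, mem_insert_self, if_true, if_false,
    tensorProj_insert_apply_of_ne hi hxy]
  ring

end Fold

section SpectralNorm

open scoped Matrix.Norms.L2Operator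

variable {m k : Type*} [Fintype m] [Fintype k] [DecidableEq k]

lemma sum_mulVec_sq_le_specNorm (A : Matrix m k ℝ) (v : k → ℝ) :
    ∑ x, (A *ᵥ v) x ^ 2 ≤ specNorm A ^ 2 * ∑ y, v y ^ 2 := by
  have h := A.l2_opNorm_mulVec (WithLp.toLp 2 v)
  have h2 := pow_le_pow_left₀ (norm_nonneg _) h 2
  rw [mul_pow, EuclideanSpace.real_norm_sq_eq, EuclideanSpace.real_norm_sq_eq] at h2
  exact h2

lemma specNorm_le_of_sum_mulVec_sq_le {A : Matrix m k ℝ} {B : ℝ} (hB : 0 ≤ B)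
    (h : ∀ v : k → ℝ, ∑ x, (A *ᵥ v) x ^ 2 ≤ B ^ 2 * ∑ y, v y ^ 2) : specNorm A ≤ B := by
  rw [specNorm, Matrix.l2_opNorm_def]
  refine ContinuousLinearMap.opNorm_le_bound _ hB fun v => ?_
  refine le_of_sq_le_sq ?_ (by positivity)
  rw [mul_pow, EuclideanSpace.real_norm_sq_eq, EuclideanSpace.real_norm_sq_eq]
  exact h v

lemma specNorm_nonneg (A : Matrix m k ℝ) : 0 ≤ specNorm A := norm_nonneg A

lemma specNorm_pos_iff {A : Matrix m k ℝ} : 0 < specNorm A ↔ A ≠ 0 := norm_pos_iff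

lemma specNorm_sub_le (A B : Matrix m k ℝ) : specNorm (A - B) ≤ specNorm A + specNorm B :=
  norm_sub_le A B

lemma specNorm_submatrix_id_le {l : Type*} [Fintype l] [DecidableEq l] (A : Matrix m k ℝ)
    {f : l → k} (hf : Function.Injective f) : specNorm (A.submatrix id f) ≤ specNorm A := by
  refine specNorm_le_of_sum_mulVec_sq_le (specNorm_nonneg A) fun v => ?_
  set v' : k → ℝ := Function.extend f v 0
  have hrange (y : l) : v' (f y) = v y := hf.extend_apply v 0 y
  have hoff : ∀ y ∉ Set.range f, v' y = 0 := fun y hy => Function.extend_apply' _ _ y hy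
  have hA : A.submatrix id f *ᵥ v = A *ᵥ v' := by
    ext x
    refine Fintype.sum_of_injective f hf _ _ (fun y hy => ?_) fun y => ?_
    · rw [hoff y hy, mul_zero]
    · rw [hrange]
      rfl
  have hv : ∑ y, v y ^ 2 = ∑ y, v' y ^ 2 := by
    refine Fintype.sum_of_injective f hf _ _ (fun y hy => ?_) fun y => ?_
    · rw [hoff y hy, sq, mul_zero]
    · rw [hrange]
  rw [hA, hv]
  exact sum_mulVec_sq_le_specNorm A v'

variable {κ : Type*} [Finite κ] [DecidableEq κ]

lemma specNorm_label_eq_le (A : Matrix m k ℝ) (ξ : m → κ) (η : k → κ) :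
    specNorm (Matrix.of fun x y => if ξ x = η y then A x y else 0) ≤ specNorm A := by
  refine specNorm_le_of_sum_mulVec_sq_le (specNorm_nonneg A) fun v => ?_
  cases nonempty_fintype κ
  set part : κ → k → ℝ := fun c y => if η y = c then v y else 0
  calc ∑ x, (Matrix.of (fun x y => if ξ x = η y then A x y else 0) *ᵥ v) x ^ 2
      = ∑ x, (A *ᵥ part (ξ x)) x ^ 2 := by
        simp [part, Matrix.mulVec, dotProduct, eq_comm]
    _ ≤ ∑ x, ∑ c, (A *ᵥ part c) x ^ 2 := by
        gcongr with x
        exact single_le_sum (f := fun c => (A *ᵥ part c) x ^ 2) (fun c _ => sq_nonneg _)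
          (mem_univ (ξ x))
    _ = ∑ c, ∑ x, (A *ᵥ part c) x ^ 2 := sum_comm
    _ ≤ ∑ c, specNorm A ^ 2 * ∑ y, part c y ^ 2 :=
        sum_le_sum fun c _ => sum_mulVec_sq_le_specNorm A (part c)
    _ = specNorm A ^ 2 * ∑ y, v y ^ 2 := by
        rw [← mul_sum, sum_comm]
        simp [part, ite_pow]

lemma specNorm_label_ne_le (A : Matrix m k ℝ) (ξ : m → κ) (η : k → κ) :
    specNorm (Matrix.of fun x y => if ξ x = η y then 0 else A x y) ≤ 2 * specNorm A := by
  have hsub : (Matrix.of fun x y => if ξ x = η y then 0 else A x y)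
      = A - Matrix.of fun x y => if ξ x = η y then A x y else 0 := by
    ext x y
    by_cases h : ξ x = η y <;> simp [h]
  rw [hsub]
  linarith [specNorm_sub_le A (Matrix.of fun x y => if ξ x = η y then A x y else 0),
    specNorm_label_eq_le A ξ η]

end SpectralNorm

section Blocks

section

variable {ι : Type*} [DecidableEq ι] {a b : ι}

/-- The eigenvalues of the block `G_{a,b}`, up to the factor `√q`. The missing summand `E₁ ⊗ E₁` of
`F₀ + F₁` makes them vanish on the supports containing both `a` and `b`. -/
def blockCoeff (α : ℕ → ℝ) (a b : ι) (S : Finset ι) : ℝ :=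
  if a ∈ S ∧ b ∈ S then 0 else α #(S \ {a, b})

lemma blockCoeff_nonneg {α : ℕ → ℝ} (hα : ∀ k, 0 ≤ α k) (S : Finset ι) :
    0 ≤ blockCoeff α a b S := by
  unfold blockCoeff
  split_ifs
  exacts [le_rfl, hα _]

lemma blockCoeff_comm (α : ℕ → ℝ) (a b : ι) : blockCoeff α a b = blockCoeff α b a := by
  ext S
  simp only [blockCoeff, and_comm, pair_comm]

end

lemma sum_powerset_filter_eq_sum_subtype {ι M : Type*} [Fintype ι] [AddCommMonoid M]
    (p : ι → Prop) [DecidablePred p] (f : Finset ι → M) :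
    ∑ S ∈ ({i | p i} : Finset ι).powerset, f S
      = ∑ U : Finset {i // p i}, f (U.map (Function.Embedding.subtype p)) := by
  have hmem {S : Finset ι} (hS : S ∈ ({i | p i} : Finset ι).powerset) : ∀ i ∈ S, p i :=
    fun i hi => (mem_filter.1 (mem_powerset.1 hS hi)).2
  refine sum_nbij' (fun S => S.subtype p) (fun U => U.map (Function.Embedding.subtype p))
    (fun S _ => mem_univ _) (fun U _ => ?_) (fun S hS => subtype_map_of_mem (hmem hS))
    (fun U _ => ?_) fun S hS => by rw [subtype_map_of_mem (hmem hS)]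
  · simp +contextual [subset_iff]
  · ext i
    simp [i.2]

variable {ι : Type} [Fintype ι] [DecidableEq ι] {q : ℕ} {a b : ι}

lemma univ_eq_insert_insert_filter (a b : ι) :
    (univ : Finset ι) = insert a (insert b ({i | i ≠ a ∧ i ≠ b} : Finset ι)) := by
  ext i
  by_cases ha : i = a <;> by_cases hb : i = b <;> simp [ha, hb]

lemma sum_finset_eq_sum_subtype {M : Type*} [AddCommMonoid M] (hab : a ≠ b)
    (f : Finset ι → M) :
    ∑ S, f S = ∑ U : Finset {i // i ≠ a ∧ i ≠ b},
      (f (U.map (.subtype _)) + f (insert b (U.map (.subtype _)))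
        + (f (insert a (U.map (.subtype _))) + f (insert a (insert b (U.map (.subtype _)))))) := by
  have hb : b ∉ ({i | i ≠ a ∧ i ≠ b} : Finset ι) := by simp
  have ha : a ∉ insert b ({i | i ≠ a ∧ i ≠ b} : Finset ι) := by simp [hab]
  rw [← powerset_univ, univ_eq_insert_insert_filter a b, sum_powerset_insert ha,
    sum_powerset_insert hb, sum_powerset_insert hb, ← sum_add_distrib, ← sum_add_distrib,
    ← sum_add_distrib, sum_powerset_filter_eq_sum_subtype]

lemma tensorProj_apply_eq_mul (hab : a ≠ b) (S : Finset ι) (x y : ι → Fin q) :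
    tensorProj q S x y = (if a ∈ S then E1 q (x a) (y a) else E0 q (x a) (y a)) *
      ((if b ∈ S then E1 q (x b) (y b) else E0 q (x b) (y b)) *
        tensorProj q (S.subtype fun i => i ≠ a ∧ i ≠ b) (fun i => x i) (fun i => y i)) := by
  rw [tensorProj_apply, univ_eq_insert_insert_filter a b, prod_insert (by simp [hab]),
    prod_insert (by simp),
    prod_subtype _ (p := fun i => i ≠ a ∧ i ≠ b) (F := inferInstance) (by simp)]
  simp only [tensorProj_apply, mem_subtype]

lemma sum_mul_hammingProj (α : ℕ → ℝ) (x y : ι → Fin q) :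
    ∑ k ∈ range (Fintype.card ι + 1), α k * hammingProj q ι k x y
      = ∑ U : Finset ι, α #U * tensorProj q U x y := by
  rw [← powerset_univ, sum_powerset, card_univ]
  refine sum_congr rfl fun k _ => ?_
  simp only [hammingProj, Matrix.of_apply, mul_sum]
  refine sum_congr rfl fun U hU => ?_
  rw [(mem_powersetCard.1 hU).2, tensorProj_apply]

lemma F_zero_add_F_one_apply (s t u : Fin q) :
    (F q 0 + F q 1) s (t, u) = √(q : ℝ) *
      (E0 q s t * E0 q s u + E0 q s t * E1 q s u + E1 q s t * E0 q s u) := by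
  simp [F, hammingProj, powersetCard_one, Fin.prod_univ_two, Fin.sum_univ_two]
  ring

lemma schemeMatrix_blockCoeff_apply (hab : a ≠ b) (α : ℕ → ℝ) (x y : ι → Fin q) :
    schemeMatrix q (blockCoeff α a b) x y
      = (E0 q (x a) (y a) * E0 q (x b) (y b) + E0 q (x a) (y a) * E1 q (x b) (y b)
          + E1 q (x a) (y a) * E0 q (x b) (y b))
        * ∑ U : Finset {i // i ≠ a ∧ i ≠ b},
            α #U * tensorProj q U (fun i => x i) (fun i => y i) := by
  rw [schemeMatrix_apply, sum_finset_eq_sum_subtype hab, mul_sum]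
  refine sum_congr rfl fun U _ => ?_
  set V : Finset ι := U.map (.subtype _)
  have ha : a ∉ V := by simp [V]
  have hb : b ∉ V := by simp [V]
  have hsub : V.subtype (fun i => i ≠ a ∧ i ≠ b) = U := by
    ext i
    simp [V, i.2]
  have hsub_a (T : Finset ι) :
      (insert a T).subtype (fun i => i ≠ a ∧ i ≠ b) = T.subtype fun i => i ≠ a ∧ i ≠ b := by
    ext i
    simp [i.2.1]
  have hsub_b (T : Finset ι) :
      (insert b T).subtype (fun i => i ≠ a ∧ i ≠ b) = T.subtype fun i => i ≠ a ∧ i ≠ b := by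
    ext i
    simp [i.2.2]
  have hcard : #(V \ {a, b}) = #U := by
    rw [sdiff_eq_self_of_disjoint (by simp [ha, hb]), card_map]
  simp [tensorProj_apply_eq_mul hab, blockCoeff, hsub, hsub_a, hsub_b, hcard,
    insert_sdiff_of_mem, ha, hb, hab, hab.symm]
  ring

lemma G_eq_mul_schemeMatrix {n : ℕ} {a b : Fin n} (hab : a ≠ b) (α : ℕ → ℝ)
    {x : Fin n → Fin q} (hx : x a = x b) (y : Fin n → Fin q) :
    G n q α a b x y = √q * schemeMatrix q (blockCoeff α a b) x y := by
  have hcard : n - 1 = Fintype.card {i : Fin n // i ≠ a ∧ i ≠ b} + 1 := by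
    have h := congrArg card (univ_eq_insert_insert_filter a b)
    rw [card_insert_of_notMem (by simp [hab]), card_insert_of_notMem (by simp), card_univ,
      Fintype.card_fin, ← Fintype.card_subtype] at h
    omega
  rw [schemeMatrix_blockCoeff_apply hab, ← sum_mul_hammingProj, ← hcard, G, hx, ← mul_assoc,
    ← F_zero_add_F_one_apply, mul_sum]
  exact sum_congr rfl fun k _ => mul_left_comm _ _ _

end Blocks

section StackedBlocks

variable {n q : ℕ}

/-- The blocks `√q ∑_S t_{a,b}(S) E_S`, restricted to the rows `x` with `x a = x b` and stacked on
one another for all `a < b`. The enlarged matrix is of this form, and so are its images under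
`foldCoeff`. -/
def stackedBlocks (q : ℕ) (t : Fin n → Fin n → Finset (Fin n) → ℝ) :
    Matrix (ExtRow n q) (Fin n → Fin q) ℝ :=
  Matrix.of fun r y => √q * schemeMatrix q (t r.1.1.1 r.1.1.2) r.1.2 y

lemma stackedBlocks_apply (t : Fin n → Fin n → Finset (Fin n) → ℝ) (r : ExtRow n q)
    (y : Fin n → Fin q) :
    stackedBlocks q t r y = √q * schemeMatrix q (t r.1.1.1 r.1.1.2) r.1.2 y := rfl

lemma enlargedMatrix_eq_stackedBlocks (α : ℕ → ℝ) :
    enlargedMatrix n q α = stackedBlocks q (blockCoeff α) := by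
  ext r y
  exact G_eq_mul_schemeMatrix r.2.1.ne α r.2.2 y

lemma stackedBlocks_mulVec (t : Fin n → Fin n → Finset (Fin n) → ℝ) (v : (Fin n → Fin q) → ℝ)
    (r : ExtRow n q) :
    (stackedBlocks q t *ᵥ v) r = √q * (schemeMatrix q (t r.1.1.1 r.1.1.2) *ᵥ v) r.1.2 := by
  simp only [Matrix.mulVec, dotProduct, stackedBlocks_apply, mul_sum, mul_assoc]

lemma sum_extRow (g : Fin n → Fin n → (Fin n → Fin q) → ℝ) :
    ∑ r : ExtRow n q, g r.1.1.1 r.1.1.2 r.1.2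
      = ∑ p : Fin n × Fin n with p.1 < p.2, ∑ x with x p.1 = x p.2, g p.1 p.2 x := by
  rw [← sum_subtype (univ.filter fun r : (Fin n × Fin n) × (Fin n → Fin q) =>
    r.1.1 < r.1.2 ∧ r.2 r.1.1 = r.2 r.1.2) (by simp) fun r => g r.1.1 r.1.2 r.2]
  simp only [sum_filter, Fintype.sum_prod_type, ite_and, sum_ite_irrel, sum_const_zero]

lemma sum_stackedBlocks_mulVec_sq (t : Fin n → Fin n → Finset (Fin n) → ℝ)
    (v : (Fin n → Fin q) → ℝ) :
    ∑ r, (stackedBlocks q t *ᵥ v) r ^ 2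
      = ∑ p : Fin n × Fin n with p.1 < p.2,
          q * ∑ x with x p.1 = x p.2, (schemeMatrix q (t p.1 p.2) *ᵥ v) x ^ 2 := by
  simp only [stackedBlocks_mulVec, mul_pow, Real.sq_sqrt (Nat.cast_nonneg q), ← mul_sum]
  rw [sum_extRow fun a b x => (schemeMatrix q (t a b) *ᵥ v) x ^ 2]

end StackedBlocks

section LegalRows

variable {n q : ℕ}

lemma elementDistinctness_eq_false_iff {x : Fin n → Fin q} :
    elementDistinctness n q x = false ↔ Function.Injective x := by
  simp only [elementDistinctness, decide_eq_false_iff_not, Function.Injective]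
  push Not
  exact forall₂_congr fun i j => not_imp_not

lemma ExtRow.Legal.eq {r s : ExtRow n q} (hr : r.Legal) (h : r.1.2 = s.1.2) : r = s :=
  Subtype.ext (Prod.ext (hr s.1.1.1 s.1.1.2 s.2.1 (h ▸ s.2.2)).symm h)

/-- A row of a block, as a positive input. -/
def ExtRow.toPos (r : ExtRow n q) : Pos (elementDistinctness n q) :=
  ⟨r.1.2, decide_eq_true ⟨r.1.1.1, r.1.1.2, r.2.1.ne, r.2.2⟩⟩

open Classical in
/-- The matrix that strikes out the illegal rows and moves each legal row to its positive input:
`struckMatrix` is obtained by multiplying with it on the left. -/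
def legalSelection (n q : ℕ) : Matrix (Pos (elementDistinctness n q)) (ExtRow n q) ℝ :=
  Matrix.of fun x r => if r.Legal ∧ r.1.2 = x.1 then 1 else 0

lemma struckMatrix_eq_legalSelection_mul (α : ℕ → ℝ) :
    struckMatrix n q α = legalSelection n q * (enlargedMatrix n q α).submatrix id Subtype.val := by
  ext x y
  simp [struckMatrix, legalSelection, Matrix.mul_apply]

lemma struckMatrix_hadamard_Delta (α : ℕ → ℝ) (i : Fin n) :
    struckMatrix n q α ⊙ Delta (elementDistinctness n q) i = legalSelection n q *
      (Matrix.of fun r y => if r.1.2 i = y i then 0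
        else stackedBlocks q (fun a b => foldCoeff i (blockCoeff α a b)) r y).submatrix
          id Subtype.val := by
  rw [struckMatrix_eq_legalSelection_mul, enlargedMatrix_eq_stackedBlocks]
  ext x y
  simp only [Matrix.hadamard_apply, Matrix.mul_apply, Matrix.submatrix_apply, id, sum_mul,
    legalSelection, Delta, Matrix.of_apply, stackedBlocks_apply]
  refine sum_congr rfl fun r _ => ?_
  by_cases hr : r.Legal ∧ r.1.2 = x.1
  · by_cases hi : r.1.2 i = y.1 i
    · simp [hi, ← hr.2]
    · simp [hi, hr.1, ← hr.2, schemeMatrix_foldCoeff_apply _ hi]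
  · simp [hr]

open Classical in
lemma sum_legalSelection_mulVec_sq (g : ExtRow n q → ℝ) :
    ∑ x, (legalSelection n q *ᵥ g) x ^ 2 = ∑ r with r.Legal, g r ^ 2 := by
  have hlegal (r : ExtRow n q) (hr : r.Legal) : (legalSelection n q *ᵥ g) r.toPos = g r := by
    rw [Matrix.mulVec, dotProduct, Fintype.sum_eq_single r fun s hs => ?_]
    · simp [legalSelection, ExtRow.toPos, hr]
    · rw [legalSelection, Matrix.of_apply, if_neg fun h => hs (h.1.eq h.2), zero_mul]
  symm
  refine sum_of_injOn ExtRow.toPos (fun r hr s _ h => ?_) (fun r _ => mem_coe.2 (mem_univ _))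
    (fun x _ hx => ?_) fun r hr => ?_
  · exact (mem_filter.1 hr).2.eq (congrArg Subtype.val h)
  · have hzero (r : ExtRow n q) : ¬ (r.Legal ∧ r.1.2 = x.1) := fun h =>
      hx ⟨r, by simpa using h.1, Subtype.ext h.2⟩
    simp [Matrix.mulVec, dotProduct, legalSelection, hzero]
  · rw [hlegal r (mem_filter.1 hr).2]

lemma specNorm_legalSelection_mul_le {k : Type*} [Fintype k] [DecidableEq k]
    (A : Matrix (ExtRow n q) k ℝ) : specNorm (legalSelection n q * A) ≤ specNorm A := by
  classical
  refine specNorm_le_of_sum_mulVec_sq_le (specNorm_nonneg A) fun v => ?_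
  calc ∑ x, ((legalSelection n q * A) *ᵥ v) x ^ 2
      = ∑ r with r.Legal, (A *ᵥ v) r ^ 2 := by
        rw [← Matrix.mulVec_mulVec, sum_legalSelection_mulVec_sq]
    _ ≤ ∑ r, (A *ᵥ v) r ^ 2 :=
        sum_le_sum_of_subset_of_nonneg (filter_subset _ _) fun r _ _ => sq_nonneg _
    _ ≤ specNorm A ^ 2 * ∑ y, v y ^ 2 := sum_mulVec_sq_le_specNorm A v

end LegalRows

section UpperBound

section

variable {ι : Type*} [DecidableEq ι] {i : ι} {S : Finset ι}

lemma foldCoeff_of_mem (t : Finset ι → ℝ) (hi : i ∈ S) : foldCoeff i t S = 0 := if_pos hi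

lemma foldCoeff_blockCoeff_sq_le {α : ℕ → ℝ} {δ : ℝ} (hα : ∀ k, |α k - α (k + 1)| ≤ δ)
    {a b : ι} (ha : i ≠ a) (hb : i ≠ b) (S : Finset ι) :
    foldCoeff i (blockCoeff α a b) S ^ 2 ≤ δ ^ 2 := by
  by_cases hi : i ∈ S
  · simp [foldCoeff_of_mem _ hi, sq_nonneg]
  · have hcard : #(insert i S \ {a, b}) = #(S \ {a, b}) + 1 := by
      rw [insert_sdiff_of_notMem _ (by simp [ha, hb]), card_insert_of_notMem (by simp [hi])]
    simp only [foldCoeff, hi, if_false, blockCoeff, mem_insert, ha.symm, hb.symm, false_or, hcard]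
    split_ifs
    · simp [sq_nonneg]
    · exact sq_le_sq' (abs_le.1 (hα _)).1 (abs_le.1 (hα _)).2

lemma foldCoeff_blockCoeff_self (α : ℕ → ℝ) {b : ι} (hib : i ≠ b) (S : Finset ι) :
    foldCoeff i (blockCoeff α i b) S = if i ∉ S ∧ b ∈ S then α (#S - 1) else 0 := by
  by_cases hi : i ∈ S
  · simp [foldCoeff_of_mem _ hi, hi]
  · by_cases hb : b ∈ S
    · have hcard : #(S \ {i, b}) = #S - 1 := by
        rw [sdiff_insert, erase_eq_of_notMem (by simp [hi]), card_sdiff_of_subset (by simpa),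
          card_singleton]
      simp [foldCoeff, blockCoeff, hi, hb, hcard]
    · simp [foldCoeff, blockCoeff, hi, hb, hib.symm, insert_sdiff_of_mem]

end

variable {ι : Type*} [Fintype ι] [DecidableEq ι] {q : ℕ}

/-- The contribution of the block `G_{i,b}` to `‖(Γ' ∘ Δ_i) v‖²` after folding. -/
def foldEnergy (α : ℕ → ℝ) (i b : ι) (v : (ι → Fin q) → ℝ) : ℝ :=
  ∑ S with i ∉ S ∧ b ∈ S, α (#S - 1) ^ 2 * energy S v

lemma foldEnergy_nonneg (α : ℕ → ℝ) (i b : ι) (v : (ι → Fin q) → ℝ) : 0 ≤ foldEnergy α i b v :=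
  sum_nonneg fun S _ => mul_nonneg (sq_nonneg _) (energy_nonneg S v)

lemma sum_foldEnergy_le {α : ℕ → ℝ} {K : ℝ} (hα : ∀ k : ℕ, (k + 1) * α k ^ 2 ≤ K) (i : ι)
    (v : (ι → Fin q) → ℝ) : ∑ b, foldEnergy α i b v ≤ K * ∑ x, v x ^ 2 := by
  have hK : 0 ≤ K := le_trans (by positivity) (hα 0)
  have hcard (S : Finset ι) : #S * α (#S - 1) ^ 2 ≤ K := by
    rcases Nat.eq_zero_or_pos #S with h0 | h0
    · simpa [h0] using hK
    · simpa [← Nat.cast_add_one, Nat.sub_add_cancel h0] using hα (#S - 1)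
  calc ∑ b, foldEnergy α i b v
      = ∑ S with i ∉ S, #S * (α (#S - 1) ^ 2 * energy S v) := by
        simp only [foldEnergy, sum_filter, ite_and]
        rw [sum_comm]
        refine sum_congr rfl fun S _ => ?_
        split_ifs <;> simp
    _ ≤ ∑ S with i ∉ S, K * energy S v := by
        refine sum_le_sum fun S _ => ?_
        rw [← mul_assoc]
        exact mul_le_mul_of_nonneg_right (hcard S) (energy_nonneg S v)
    _ ≤ ∑ S, K * energy S v := sum_le_sum_of_subset_of_nonneg (filter_subset _ _)
        fun S _ _ => mul_nonneg hK (energy_nonneg S v)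
    _ = K * ∑ x, v x ^ 2 := by rw [← mul_sum, sum_energy]

lemma mul_sum_diagonal_foldCoeff_self (α : ℕ → ℝ) {i b : ι} (hib : i ≠ b)
    (v : (ι → Fin q) → ℝ) :
    q * ∑ x with x i = x b, (schemeMatrix q (foldCoeff i (blockCoeff α i b)) *ᵥ v) x ^ 2
      = foldEnergy α i b v := by
  rw [mul_sum_diagonal_schemeMatrix_mulVec_sq hib fun S hS => foldCoeff_of_mem _ hS, foldEnergy,
    sum_filter]
  refine sum_congr rfl fun S _ => ?_
  rw [foldCoeff_blockCoeff_self α hib]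
  split_ifs <;> simp

lemma mul_sum_diagonal_foldCoeff_le {α : ℕ → ℝ} {δ : ℝ} (hα : ∀ k, |α k - α (k + 1)| ≤ δ)
    {a b i : ι} (hab : a ≠ b) (ha : i ≠ a) (hb : i ≠ b) (v : (ι → Fin q) → ℝ) :
    q * ∑ x with x a = x b, (schemeMatrix q (foldCoeff i (blockCoeff α a b)) *ᵥ v) x ^ 2
      ≤ 2 * δ ^ 2 * ∑ x, v x ^ 2 := by
  refine (mul_sum_diagonal_schemeMatrix_mulVec_sq_le hab ?_ v).trans ?_
  · intro S haS hbS
    simp [foldCoeff, blockCoeff, haS, hbS]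
  · rw [mul_assoc, ← sum_energy, mul_sum (a := δ ^ 2)]
    exact mul_le_mul_of_nonneg_left (sum_le_sum fun S _ => mul_le_mul_of_nonneg_right
      (foldCoeff_blockCoeff_sq_le hα ha hb S) (energy_nonneg S v)) zero_le_two

lemma mul_sum_diagonal_foldCoeff_le_add {α : ℕ → ℝ} {δ : ℝ} (hα : ∀ k, |α k - α (k + 1)| ≤ δ)
    {a b : ι} (hab : a ≠ b) (i : ι) (v : (ι → Fin q) → ℝ) :
    q * ∑ x with x a = x b, (schemeMatrix q (foldCoeff i (blockCoeff α a b)) *ᵥ v) x ^ 2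
      ≤ 2 * δ ^ 2 * ∑ x, v x ^ 2 + (if a = i then foldEnergy α i b v else 0)
        + if b = i then foldEnergy α i a v else 0 := by
  have hV : 0 ≤ 2 * δ ^ 2 * ∑ x, v x ^ 2 := by positivity
  rcases eq_or_ne a i with rfl | ha
  · rw [mul_sum_diagonal_foldCoeff_self α hab, if_pos rfl, if_neg hab.symm]
    linarith
  rcases eq_or_ne b i with rfl | hb
  · have hcomm (x : ι → Fin q) : x a = x b ↔ x b = x a := eq_comm
    rw [blockCoeff_comm, if_neg ha, if_pos rfl]
    simp only [hcomm]
    rw [mul_sum_diagonal_foldCoeff_self α hab.symm]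
    linarith
  · rw [if_neg ha, if_neg hb, add_zero, add_zero]
    exact mul_sum_diagonal_foldCoeff_le hα hab ha.symm hb.symm v

variable {n : ℕ} {α : ℕ → ℝ} {δ K : ℝ}

lemma sum_stackedBlocks_foldCoeff_mulVec_sq_le (hδ : ∀ k, |α k - α (k + 1)| ≤ δ)
    (hK : ∀ k : ℕ, (k + 1) * α k ^ 2 ≤ K) (i : Fin n) (v : (Fin n → Fin q) → ℝ) :
    ∑ r, (stackedBlocks q (fun a b => foldCoeff i (blockCoeff α a b)) *ᵥ v) r ^ 2
      ≤ 2 * ((n * δ) ^ 2 + K) * ∑ x, v x ^ 2 := by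
  set V := ∑ x, v x ^ 2
  rw [sum_stackedBlocks_mulVec_sq]
  calc ∑ p : Fin n × Fin n with p.1 < p.2, q * ∑ x with x p.1 = x p.2,
          (schemeMatrix q (foldCoeff i (blockCoeff α p.1 p.2)) *ᵥ v) x ^ 2
      ≤ ∑ p : Fin n × Fin n with p.1 < p.2,
          (2 * δ ^ 2 * V + (if p.1 = i then foldEnergy α i p.2 v else 0)
            + if p.2 = i then foldEnergy α i p.1 v else 0) :=
        sum_le_sum fun p hp =>
          mul_sum_diagonal_foldCoeff_le_add hδ (mem_filter.1 hp).2.ne i v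
    _ ≤ ∑ p : Fin n × Fin n,
          (2 * δ ^ 2 * V + (if p.1 = i then foldEnergy α i p.2 v else 0)
            + if p.2 = i then foldEnergy α i p.1 v else 0) := by
        refine sum_le_sum_of_subset_of_nonneg (filter_subset _ _) fun p _ _ => ?_
        have h₁ := foldEnergy_nonneg α i p.1 v
        have h₂ := foldEnergy_nonneg α i p.2 v
        positivity
    _ = 2 * (n * δ) ^ 2 * V + 2 * ∑ b, foldEnergy α i b v := by
        simp only [sum_add_distrib, Fintype.sum_prod_type, sum_const, card_univ, Fintype.card_prod,
          Fintype.card_fin, Nat.cast_mul, nsmul_eq_mul, mul_zero, sum_ite_irrel, sum_ite_eq',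
          mem_univ, if_true]
        ring
    _ ≤ 2 * ((n * δ) ^ 2 + K) * V := by linarith [sum_foldEnergy_le hK i v]

lemma specNorm_struckMatrix_hadamard_Delta_le (hδ : ∀ k, |α k - α (k + 1)| ≤ δ)
    (hK : ∀ k : ℕ, (k + 1) * α k ^ 2 ≤ K) (i : Fin n) :
    specNorm (struckMatrix n q α ⊙ Delta (elementDistinctness n q) i)
      ≤ 2 * √(2 * ((n * δ) ^ 2 + K)) := by
  have hK0 : 0 ≤ K := le_trans (by positivity) (hK 0)
  set A : Matrix (ExtRow n q) (Fin n → Fin q) ℝ :=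
    stackedBlocks q fun a b => foldCoeff i (blockCoeff α a b) with hA
  have hnorm : specNorm A ≤ √(2 * ((n * δ) ^ 2 + K)) := by
    refine specNorm_le_of_sum_mulVec_sq_le (Real.sqrt_nonneg _) fun v => ?_
    rw [Real.sq_sqrt (by positivity)]
    exact sum_stackedBlocks_foldCoeff_mulVec_sq_le hδ hK i v
  calc specNorm (struckMatrix n q α ⊙ Delta (elementDistinctness n q) i)
      ≤ specNorm (Matrix.of fun r y => if r.1.2 i = y i then 0 else A r y) := by
        rw [struckMatrix_hadamard_Delta, ← hA]
        exact (specNorm_legalSelection_mul_le _).trans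
          (specNorm_submatrix_id_le _ Subtype.val_injective)
    _ ≤ 2 * specNorm A := specNorm_label_ne_le A (fun r => r.1.2 i) fun y => y i
    _ ≤ 2 * √(2 * ((n * δ) ^ 2 + K)) := mul_le_mul_of_nonneg_left hnorm zero_le_two

lemma maxDeltaNorm_struckMatrix_le (hδ : ∀ k, |α k - α (k + 1)| ≤ δ)
    (hK : ∀ k : ℕ, (k + 1) * α k ^ 2 ≤ K) :
    maxDeltaNorm (elementDistinctness n q) (struckMatrix n q α)
      ≤ 2 * √(2 * ((n * δ) ^ 2 + K)) :=
  Real.iSup_le (specNorm_struckMatrix_hadamard_Delta_le hδ hK) (by positivity)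

end UpperBound

section LowerBound

variable {n q : ℕ} {α : ℕ → ℝ}

lemma card_pairs_lt (n : ℕ) : #{p : Fin n × Fin n | p.1 < p.2} = n.choose 2 := by
  rw [← univ_product_univ, card_product_filter_lt, card_univ, Fintype.card_fin]

lemma mul_sum_extRow_coordAvg_sq_le [NeZero q] (w : (Fin n → Fin q) → ℝ) :
    q * ∑ r : ExtRow n q, coordAvg r.1.1.1 w r.1.2 ^ 2 ≤ n.choose 2 * ∑ x, w x ^ 2 := by
  rw [sum_extRow fun a _ x => coordAvg a w x ^ 2, mul_sum, ← card_pairs_lt, ← nsmul_eq_mul]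
  refine sum_le_card_nsmul _ _ _ fun p hp => ?_
  have hdep : DependsOn (fun x => coordAvg p.1 w x ^ 2) {p.1}ᶜ := fun x y hxy => by
    simp only [dependsOn_coordAvg p.1 w hxy]
  have hdiag := card_smul_sum_diagonal (mem_filter.1 hp).2.ne hdep
  rw [Fintype.card_fin, nsmul_eq_mul] at hdiag
  exact hdiag.trans_le (sum_coordAvg_sq_le p.1 w)

lemma le_mul_sum_coordAvg_mul_schemeMatrix_blockCoeff [NeZero q] (hα : ∀ k, 0 ≤ α k)
    {ι : Type*} [Fintype ι] [DecidableEq ι] {a b : ι} (hab : a ≠ b) {w : (ι → Fin q) → ℝ}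
    (hw : ∀ x, w (x ∘ Equiv.swap a b) = w x) :
    α 0 * ((∑ x, w x) ^ 2 / (q : ℝ) ^ Fintype.card ι)
      ≤ q * ∑ x with x a = x b,
          coordAvg a w x * (schemeMatrix q (blockCoeff α a b) *ᵥ w) x := by
  have hvanish (S : Finset ι) (ha : a ∈ S) (hb : b ∈ S) : blockCoeff α a b S = 0 :=
    if_pos ⟨ha, hb⟩
  have hempty : blockCoeff α a b ∅ = α 0 := by simp [blockCoeff]
  rw [mul_sum_diagonal_coordAvg_mul_schemeMatrix_mulVec hab hvanish hw, ← energy_empty, ← hempty]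
  exact single_le_sum (f := fun S => blockCoeff α a b S * energy S w)
    (fun S _ => mul_nonneg (blockCoeff_nonneg hα S) (energy_nonneg S w)) (mem_univ ∅)

lemma le_sqrt_mul_sum_coordAvg_mul_enlargedMatrix_mulVec [NeZero q] (hα : ∀ k, 0 ≤ α k)
    {w : (Fin n → Fin q) → ℝ} (hw : ∀ a b x, w (x ∘ Equiv.swap a b) = w x) :
    n.choose 2 * (α 0 * ((∑ x, w x) ^ 2 / (q : ℝ) ^ n))
      ≤ √q * ∑ r, coordAvg r.1.1.1 w r.1.2 * (enlargedMatrix n q α *ᵥ w) r := by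
  have hsqrt : √(q : ℝ) * √q = q := Real.mul_self_sqrt (Nat.cast_nonneg q)
  simp only [enlargedMatrix_eq_stackedBlocks, stackedBlocks_mulVec, mul_left_comm (coordAvg _ _ _),
    ← mul_sum (a := √(q : ℝ))]
  rw [← mul_assoc √(q : ℝ), hsqrt, sum_extRow fun a b x =>
    coordAvg a w x * (schemeMatrix q (blockCoeff α a b) *ᵥ w) x, mul_sum, ← card_pairs_lt,
    ← nsmul_eq_mul]
  refine card_nsmul_le_sum _ _ _ fun p hp => ?_
  simpa using le_mul_sum_coordAvg_mul_schemeMatrix_blockCoeff hα (mem_filter.1 hp).2.ne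
    (hw p.1 p.2)

open Classical in
/-- The indicator of the legal columns, that is, of the strings with pairwise distinct symbols. -/
def legalIndicator (n q : ℕ) (x : Fin n → Fin q) : ℝ := if Function.Injective x then 1 else 0

lemma legalIndicator_comp_equiv (e : Equiv.Perm (Fin n)) (x : Fin n → Fin q) :
    legalIndicator n q (x ∘ e) = legalIndicator n q x := by
  simp only [legalIndicator, EquivLike.injective_comp]

lemma legalIndicator_sq (x : Fin n → Fin q) : legalIndicator n q x ^ 2 = legalIndicator n q x := by
  simp [legalIndicator]

lemma submatrix_val_mulVec_one {m : Type*} (A : Matrix m (Fin n → Fin q) ℝ) :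
    A.submatrix id (Subtype.val : Neg (elementDistinctness n q) → _) *ᵥ 1
      = A *ᵥ legalIndicator n q := by
  classical
  ext r
  simp only [Matrix.mulVec, dotProduct, Matrix.submatrix_apply, id, Pi.one_apply, mul_one,
    legalIndicator, mul_ite, mul_zero, ← sum_filter]
  exact (sum_subtype _ (by simp [elementDistinctness_eq_false_iff]) (A r)).symm

lemma card_neg_elementDistinctness :
    Fintype.card (Neg (elementDistinctness n q)) = q.descFactorial n := by
  rw [Fintype.card_congr ((Equiv.subtypeEquivRight fun _ =>
      elementDistinctness_eq_false_iff).trans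
        (Equiv.subtypeInjectiveEquivEmbedding (Fin n) (Fin q))),
    Fintype.card_embedding_eq, Fintype.card_fin, Fintype.card_fin]

lemma sum_legalIndicator : ∑ x, legalIndicator n q x = q.descFactorial n := by
  simp only [legalIndicator]
  rw [sum_boole, ← card_neg_elementDistinctness, Fintype.card_subtype]
  simp only [elementDistinctness_eq_false_iff]

open Classical in
lemma sum_legal_enlargedMatrix_mulVec_legalIndicator_sq_le :
    ∑ r with r.Legal, (enlargedMatrix n q α *ᵥ legalIndicator n q) r ^ 2
      ≤ specNorm (struckMatrix n q α) ^ 2 * q.descFactorial n := by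
  rw [← sum_legalSelection_mulVec_sq, ← submatrix_val_mulVec_one, Matrix.mulVec_mulVec,
    ← struckMatrix_eq_legalSelection_mul]
  simpa [card_neg_elementDistinctness] using
    sum_mulVec_sq_le_specNorm (struckMatrix n q α) 1

lemma coordAvg_legalIndicator_of_not_legal {r : ExtRow n q} (hr : ¬ r.Legal) :
    coordAvg r.1.1.1 (legalIndicator n q) r.1.2 = 0 := by
  obtain ⟨⟨⟨a, b⟩, x⟩, hab, hx⟩ := r
  simp only [ExtRow.Legal, not_forall, Prod.mk.injEq] at hr hab hx ⊢
  obtain ⟨i, j, hij, hxij, hne⟩ := hr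
  rw [coordAvg, sum_eq_zero, zero_div]
  refine fun s _ => if_neg fun hinj => ?_
  have hoff (k l : Fin n) (hk : k ≠ a) (hl : l ≠ a) (h : x k = x l) : k = l :=
    hinj (by rwa [Function.update_of_ne hk, Function.update_of_ne hl])
  rcases eq_or_ne i a with rfl | hi
  · exact hne ⟨rfl, hoff j b hij.ne' hab.ne' (hxij.symm.trans hx)⟩
  rcases eq_or_ne j a with rfl | hj
  · exact (hij.trans hab).ne (hoff i b hi hab.ne' (hxij.trans hx))
  · exact hij.ne (hoff i j hi hj hxij)

lemma mul_sum_coordAvg_mul_enlargedMatrix_mulVec_sq_le [NeZero q] :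
    q * (∑ r, coordAvg r.1.1.1 (legalIndicator n q) r.1.2 *
        (enlargedMatrix n q α *ᵥ legalIndicator n q) r) ^ 2
      ≤ n.choose 2 * q.descFactorial n *
        (specNorm (struckMatrix n q α) ^ 2 * q.descFactorial n) := by
  classical
  set w := legalIndicator n q
  set u : ExtRow n q → ℝ := fun r => coordAvg r.1.1.1 w r.1.2
  set g := enlargedMatrix n q α *ᵥ w
  have hlegal : ∑ r with r.Legal, u r * g r = ∑ r, u r * g r :=
    sum_filter_of_ne fun r _ hr => by_contra fun h =>
      hr (by simp only [u, w, coordAvg_legalIndicator_of_not_legal h, zero_mul])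
  have hu : ∑ r with r.Legal, u r ^ 2 ≤ ∑ r, u r ^ 2 :=
    sum_le_sum_of_subset_of_nonneg (filter_subset _ _) fun r _ _ => sq_nonneg _
  have hw : ∑ x, w x ^ 2 = q.descFactorial n := by
    simp only [w, legalIndicator_sq, sum_legalIndicator]
  calc q * (∑ r, u r * g r) ^ 2
      ≤ q * ((∑ r with r.Legal, u r ^ 2) * ∑ r with r.Legal, g r ^ 2) := by
        rw [← hlegal]
        gcongr
        exact sum_mul_sq_le_sq_mul_sq _ u g
    _ ≤ q * (∑ r, u r ^ 2) * ∑ r with r.Legal, g r ^ 2 := by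
        rw [← mul_assoc]
        gcongr
    _ ≤ n.choose 2 * q.descFactorial n *
        (specNorm (struckMatrix n q α) ^ 2 * q.descFactorial n) := by
        refine mul_le_mul ?_ sum_legal_enlargedMatrix_mulVec_legalIndicator_sq_le
          (sum_nonneg fun r _ => sq_nonneg _) (by positivity)
        rw [← hw]
        exact mul_sum_extRow_coordAvg_sq_le w

lemma le_specNorm_struckMatrix (hα : ∀ k, 0 ≤ α k) :
    √(n.choose 2) * (α 0 * (q.descFactorial n / (q : ℝ) ^ n))
      ≤ specNorm (struckMatrix n q α) := by
  set B := specNorm (struckMatrix n q α)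
  set P : ℝ := ((n.choose 2 : ℕ) : ℝ)
  set N : ℝ := ((q.descFactorial n : ℕ) : ℝ) with hN
  have hB : 0 ≤ B := specNorm_nonneg _
  have hP0 : 0 ≤ P := Nat.cast_nonneg _
  have hN0 : 0 ≤ N := Nat.cast_nonneg _
  rcases hN0.eq_or_lt with hN' | hN'
  · rwa [← hN', zero_div, mul_zero, mul_zero]
  rcases hP0.eq_or_lt with hP' | hP'
  · rwa [← hP', Real.sqrt_zero, zero_mul]
  have : NeZero q := ⟨by
    rintro rfl
    have hn : 0 < n := Nat.pos_of_ne_zero fun h => by simp [P, h] at hP'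
    simp [N, Nat.descFactorial_eq_zero_iff_lt.2 hn] at hN'⟩
  set T := ∑ r, coordAvg r.1.1.1 (legalIndicator n q) r.1.2 *
    (enlargedMatrix n q α *ᵥ legalIndicator n q) r
  have hlow : P * (α 0 * (N ^ 2 / (q : ℝ) ^ n)) ≤ √q * T := by
    rw [hN, ← sum_legalIndicator]
    exact le_sqrt_mul_sum_coordAvg_mul_enlargedMatrix_mulVec hα fun a b =>
      legalIndicator_comp_equiv (Equiv.swap a b)
  have hup : q * T ^ 2 ≤ P * N * (B ^ 2 * N) := mul_sum_coordAvg_mul_enlargedMatrix_mulVec_sq_le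
  have hα0 := hα 0
  refine le_of_sq_le_sq ?_ hB
  refine le_of_mul_le_mul_left ?_ (by positivity : 0 < P * N ^ 2)
  calc P * N ^ 2 * (√P * (α 0 * (N / (q : ℝ) ^ n))) ^ 2
      = (P * (α 0 * (N ^ 2 / (q : ℝ) ^ n))) ^ 2 := by
        rw [mul_pow √P, Real.sq_sqrt hP0]
        ring
    _ ≤ (√q * T) ^ 2 := by gcongr
    _ = q * T ^ 2 := by rw [mul_pow, Real.sq_sqrt (Nat.cast_nonneg q)]
    _ ≤ P * N ^ 2 * B ^ 2 := hup.trans_eq (by ring)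

end LowerBound

section Density

variable {n q : ℕ}

lemma exp_neg_mul_pow_le_descFactorial {ε : ℝ} (hnq : n ≤ q)
    (hε : ∀ i < n, (i : ℝ) ≤ ε * (q - i)) :
    (Real.exp (-ε) * q) ^ n ≤ q.descFactorial n := by
  rw [Nat.descFactorial_eq_prod_range, Nat.cast_prod, ← card_range n, ← prod_const, card_range]
  refine prod_le_prod (fun _ _ => by positivity) fun i hi => ?_
  have hiq : i ≤ q := (mem_range.1 hi).le.trans hnq
  have hsub : (0 : ℝ) ≤ q - i := sub_nonneg.2 (mod_cast hiq)
  rw [Nat.cast_sub hiq, Real.exp_neg, inv_mul_le_iff₀ (Real.exp_pos _)]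
  calc (q : ℝ) = i + (q - i) := by ring
    _ ≤ (ε + 1) * (q - i) := by linarith [hε i (mem_range.1 hi)]
    _ ≤ Real.exp ε * (q - i) := mul_le_mul_of_nonneg_right (Real.add_one_le_exp ε) hsub

lemma min_half_mul_add_le {c x y : ℝ} (hx : 1 ≤ x) (hxy : x ≤ y) (hc : c * x ^ 2 ≤ y) :
    min 1 c / 2 * y + x ≤ y + 1 := by
  have hy : 0 ≤ y := by linarith
  rcases le_total (2 * x) y with h | h
  · have hmin : min 1 c / 2 * y ≤ 1 / 2 * y := by
      gcongr
      exact min_le_left 1 c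
    linarith
  · have hmin : min 1 c / 2 * y ≤ c / 2 * y := by
      gcongr
      exact min_le_right 1 c
    have hsq : x ^ 2 * (c / 2 * y) ≤ x ^ 2 * (y - x + 1) :=
      calc x ^ 2 * (c / 2 * y) = c * x ^ 2 * y / 2 := by ring
        _ ≤ y * y / 2 := by gcongr
        _ ≤ x ^ 2 + x * (y - x) := by nlinarith
        _ ≤ x ^ 2 * (y - x + 1) := by nlinarith [mul_nonneg (sub_nonneg.2 hx) (sub_nonneg.2 hxy)]
    linarith [le_of_mul_le_mul_left hsq (by positivity)]

lemma exp_le_descFactorial_div_pow {c : ℝ} (hc : 0 < c) (hn : 0 < n) (hnq : n ≤ q)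
    (hcq : c * (n : ℝ) ^ 2 ≤ q) :
    Real.exp (-(2 / (c * min 1 c))) ≤ q.descFactorial n / (q : ℝ) ^ n := by
  have hq : (0 : ℝ) < q := mod_cast hn.trans_le hnq
  have hδ : 0 < min 1 c / 2 := by positivity
  set δ := min 1 c / 2
  have hε (i : ℕ) (hi : i < n) : (i : ℝ) ≤ n / (δ * q) * (q - i) := by
    have hin : (i : ℝ) + 1 ≤ n := mod_cast hi
    have hδi : δ * q ≤ q - i := by
      have hδq : δ * q + n ≤ q + 1 := min_half_mul_add_le (mod_cast hn) (mod_cast hnq) hcq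
      linarith
    calc (i : ℝ) ≤ n / (δ * q) * (δ * q) := by
          rw [div_mul_cancel₀ _ (by positivity)]
          linarith
      _ ≤ n / (δ * q) * (q - i) := by gcongr
  rw [le_div_iff₀ (by positivity)]
  refine le_trans ?_ (exp_neg_mul_pow_le_descFactorial hnq hε)
  rw [mul_pow, ← Real.exp_nat_mul]
  gcongr
  rw [mul_neg, neg_le_neg_iff]
  calc n * (n / (δ * q)) = n ^ 2 / (δ * q) := by ring
    _ ≤ n ^ 2 / (δ * (c * n ^ 2)) := by gcongr
    _ = 2 / (c * min 1 c) := by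
        simp only [δ]
        field_simp

end Density

section Weights

variable {n : ℕ}

/-- The weights `α_k = max (n^{-1/3} - k/n) 0`. The value at `0` is, up to a constant, the largest
one for which `(k + 1) α_k²` stays bounded when the weights decrease to `0` in steps of `1/n`. -/
def weight (n k : ℕ) : ℝ := max ((n : ℝ) ^ (-(1 / 3) : ℝ) - k / n) 0

lemma weight_nonneg (n k : ℕ) : 0 ≤ weight n k := le_max_right _ _

lemma weight_zero (n : ℕ) : weight n 0 = (n : ℝ) ^ (-(1 / 3) : ℝ) := by
  simp only [weight, Nat.cast_zero, zero_div, sub_zero]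
  exact max_eq_left (by positivity)

lemma mul_weight_zero (n : ℕ) : n * weight n 0 = (n : ℝ) ^ (2 / 3 : ℝ) := by
  rw [weight_zero, ← Real.rpow_one_add' n.cast_nonneg (by norm_num)]
  norm_num

lemma weight_le_weight_zero (n k : ℕ) : weight n k ≤ weight n 0 := by
  unfold weight
  gcongr
  exact k.zero_le

lemma abs_weight_sub_weight_succ_le (n k : ℕ) : |weight n k - weight n (k + 1)| ≤ 1 / n := by
  refine (abs_max_sub_max_le_abs _ _ _).trans_eq ?_
  rw [sub_sub_sub_cancel_left, ← sub_div, Nat.cast_add_one, add_sub_cancel_left,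
    abs_of_nonneg (by positivity)]

lemma mul_weight_zero_cube (hn : 0 < n) : n * weight n 0 ^ 3 = 1 := by
  have hn0 : (0 : ℝ) < n := mod_cast hn
  rw [weight_zero, ← Real.rpow_natCast, ← Real.rpow_mul hn0.le]
  norm_num [Real.rpow_neg_one, hn0.ne']

lemma succ_mul_weight_sq_le (hn : 0 < n) (k : ℕ) : (k + 1) * weight n k ^ 2 ≤ 2 := by
  have hn0 : (0 : ℝ) < n := mod_cast hn
  have hz0 := weight_nonneg n 0
  set z := weight n 0 with hz
  have hz1 : z ≤ 1 := by
    rw [hz, weight_zero]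
    exact Real.rpow_le_one_of_one_le_of_nonpos (mod_cast hn) (by norm_num)
  rcases le_or_gt z (k / n) with h | h
  · rw [weight, ← weight_zero, max_eq_right (sub_nonpos.2 h)]
    norm_num
  · have hk : (k : ℝ) ≤ n * z := by
      rw [div_lt_iff₀ hn0] at h
      linarith
    calc (k + 1) * weight n k ^ 2 ≤ (n * z + 1) * z ^ 2 := by
          gcongr
          exacts [weight_nonneg n k, weight_le_weight_zero n k]
      _ = n * z ^ 3 + z ^ 2 := by ring
      _ ≤ 1 + 1 := add_le_add (mul_weight_zero_cube hn).le (pow_le_one₀ hz0 hz1)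
      _ = 2 := one_add_one_eq_two

end Weights

section Ratio

variable {n q : ℕ}

lemma maxDeltaNorm_pos {f : (Fin n → Fin q) → Bool} {Γ : AdvMatrix f} (hΓ : Γ ≠ 0) :
    0 < maxDeltaNorm f Γ := by
  obtain ⟨x, y, hxy⟩ : ∃ x y, Γ x y ≠ 0 := by
    by_contra! h
    exact hΓ (Matrix.ext h)
  obtain ⟨i, hi⟩ : ∃ i, x.1 i ≠ y.1 i := by
    by_contra! h
    have hf := x.2
    rw [funext h, y.2] at hf
    exact Bool.false_ne_true hf
  have hne : Γ ⊙ Delta f i ≠ 0 := fun h => hxy <| by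
    simpa [Delta, hi] using congrFun (congrFun h x) y
  exact (specNorm_pos_iff.2 hne).trans_le
    (le_ciSup (f := fun i => specNorm (Γ ⊙ Delta f i)) (Set.finite_range _).bddAbove i)

lemma ofReal_advRatio_le_adv {f : (Fin n → Fin q) → Bool} {Γ : AdvMatrix f} (hΓ : Γ ≠ 0) :
    ENNReal.ofReal (advRatio f Γ) ≤ adv f :=
  le_iSup₂ (f := fun (Γ : AdvMatrix f) (_ : Γ ≠ 0) => ENNReal.ofReal (advRatio f Γ)) Γ hΓ

lemma half_le_sqrt_choose_two (hn : 2 ≤ n) : (n : ℝ) / 2 ≤ √(n.choose 2) := by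
  have hn' : (2 : ℝ) ≤ n := mod_cast hn
  refine Real.le_sqrt_of_sq_le ?_
  rw [Nat.cast_choose_two]
  nlinarith

lemma le_specNorm_struckMatrix_weight {p : ℝ} (hn : 2 ≤ n)
    (hp : p ≤ q.descFactorial n / (q : ℝ) ^ n) :
    p / 2 * (n : ℝ) ^ (2 / 3 : ℝ) ≤ specNorm (struckMatrix n q (weight n)) := by
  have hw := weight_nonneg n 0
  calc p / 2 * (n : ℝ) ^ (2 / 3 : ℝ) = n / 2 * (weight n 0 * p) := by
        rw [← mul_weight_zero]
        ring
    _ ≤ n / 2 * (weight n 0 * (q.descFactorial n / (q : ℝ) ^ n)) := by gcongr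
    _ ≤ √(n.choose 2) * (weight n 0 * (q.descFactorial n / (q : ℝ) ^ n)) := by
        gcongr
        exact half_le_sqrt_choose_two hn
    _ ≤ specNorm (struckMatrix n q (weight n)) := le_specNorm_struckMatrix (weight_nonneg n)

lemma maxDeltaNorm_struckMatrix_weight_le (hn : 0 < n) :
    maxDeltaNorm (elementDistinctness n q) (struckMatrix n q (weight n)) ≤ 5 := by
  have hn0 : (n : ℝ) ≠ 0 := mod_cast hn.ne'
  refine (maxDeltaNorm_struckMatrix_le (abs_weight_sub_weight_succ_le n)
    (succ_mul_weight_sq_le hn)).trans ?_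
  have hsqrt : √(2 * ((n * (1 / n)) ^ 2 + 2 : ℝ)) ≤ 5 / 2 := by
    rw [mul_one_div_cancel hn0]
    exact Real.sqrt_le_iff.2 (by norm_num)
  linarith

end Ratio

end AdvED

end

theorem mainTheorem1 :
    ∀ c : ℝ, 0 < c → ∃ C : ℝ, 0 < C ∧
      ∀ n q : ℕ, 2 ≤ n → n ≤ q → c * (n : ℝ) ^ 2 ≤ (q : ℝ) →
        (∃ Γ : AdvED.AdvMatrix (AdvED.elementDistinctness n q),
          Γ ≠ 0 ∧
          (∃ α : ℕ → ℝ, (∀ k, 0 ≤ α k) ∧ Γ = AdvED.struckMatrix n q α) ∧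
          0 < AdvED.maxDeltaNorm (AdvED.elementDistinctness n q) Γ ∧
          C * (n : ℝ) ^ (2 / 3 : ℝ) ≤ AdvED.advRatio (AdvED.elementDistinctness n q) Γ) ∧
        ENNReal.ofReal (C * (n : ℝ) ^ (2 / 3 : ℝ)) ≤ AdvED.adv (AdvED.elementDistinctness n q) := by
  intro c hc
  set p := Real.exp (-(2 / (c * min 1 c)))
  have hp : 0 < p := Real.exp_pos _
  refine ⟨p / 10, div_pos hp (by norm_num), fun n q hn hnq hcq => ?_⟩
  have hn0 : 0 < n := by omega
  set Γ := AdvED.struckMatrix n q (AdvED.weight n)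
  have hnorm : p / 2 * (n : ℝ) ^ (2 / 3 : ℝ) ≤ AdvED.specNorm Γ :=
    AdvED.le_specNorm_struckMatrix_weight hn (AdvED.exp_le_descFactorial_div_pow hc hn0 hnq hcq)
  have hΓ : Γ ≠ 0 := AdvED.specNorm_pos_iff.1 (hnorm.trans_lt' (by positivity))
  have hpos := AdvED.maxDeltaNorm_pos hΓ
  have hratio : p / 10 * (n : ℝ) ^ (2 / 3 : ℝ) ≤ AdvED.advRatio _ Γ :=
    calc p / 10 * (n : ℝ) ^ (2 / 3 : ℝ) = p / 2 * (n : ℝ) ^ (2 / 3 : ℝ) / 5 := by ring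
      _ ≤ AdvED.advRatio _ Γ :=
        div_le_div₀ (AdvED.specNorm_nonneg Γ) hnorm hpos
          (AdvED.maxDeltaNorm_struckMatrix_weight_le hn0)
  exact ⟨⟨Γ, hΓ, ⟨AdvED.weight n, AdvED.weight_nonneg n, rfl⟩, hpos, hratio⟩,
    (ENNReal.ofReal_le_ofReal hratio).trans (AdvED.ofReal_advRatio_le_adv hΓ)⟩
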